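/- **Setting.** Let $p,d\ge 0$, $J,n\ge 1$ be integers, $\Xi=\mathbb R^d\times\{1,\dots,J\}$ (Euclidean topology on the first factor, discrete on the second), $\xi_1,\dots,\xi_n\in\Xi$, $\rho\in\mathbb R$. Let $\Theta\subset\mathbb R^p$ be compact and convex and let $\Theta'\supset\Theta$ be open. Let $f:\mathbb R^p\times\Xi\to\mathbb R$, $c:\Xi\times\Xi\to\mathbb R$, and for every $\xi\in\Xi$ let $\pi_0(\cdot|\xi)$ be a Borel probability measure on $\Xi$. A continuous function $\Xi\to\mathbb R$ is called coercive if all its sublevel sets are compact. Assume: 1. (Smoothness) For each $y\in\{1,\dots,J\}$, $(\theta,x)\mapsto f(\theta,x,y)$ is differentiable on $\mathbb R^p\times\mathbb R^d$ with continuous gradient. 2. (Bounded growth) $c$ is non-negative and continuous; for each $\xi\in\Xi$, $c(\xi,\xi)=0$, $c(\xi,\cdot)$ is coercive, and there are constants $\mu_\xi\in\mathbb R$, $\lambda_\xi\ge 0$ with $f(\theta,\zeta)\le\mu_\xi+\frac{\lambda_\xi}{2}c(\xi,\zeta)$ for all $\theta\in\Theta'$, $\zeta\in\Xi$. 3. (Reference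 distribution) For all $\xi\in\Xi$ and $y'\in\{1,\dots,J\}$, Lebesgue measure on $\mathbb R^d$ is absolutely continuous with respect to the slice $A\mapsto\pi_0(A\times\{y'\}\,|\,\xi)$. There are $a>0$ and a continuous coercive $\psi:\Xi\to\mathbb R$ such that $\mathbb E_{\zeta\sim\pi_0(\cdot|\xi)}[c(\xi,\zeta)^{1+a}]<\infty$ and $\mathbb E_{\zeta\sim\pi_0(\cdot|\xi)}[\psi(\zeta)^{1+a}]<\infty$ for all $\xi\in\Xi$, and $\|\nabla_\theta f(\theta,\zeta)\|<\psi(\zeta)$ for all $\theta\in\Theta'$, $\zeta\in\Xi$. Fix such constants $\lambda_\xi$ and a number $\lambda_{\max}$, put $\Lambda=\bigcap_{i=1}^n[\lambda_{\xi_i},\lambda_{\max}]$ and assume $\Lambda\subset(0,\infty)$. For $\beta>0$ define, for $(\theta,\lambda)\in\mathbb R^p\times\mathbb R$, $$F(\theta,\lambda)=\lambda\rho+\frac1n\sum_{i=1}^n\sup_{\zeta\in\Xi}\{f(\theta,\zeta)-\lambda c(\xi_i,\zeta)\},\qquad F^\beta(\theta,\lambda)=\lambda\rho+\frac1n\sum_{i=1}^n\beta\log\mathbb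 E_{\zeta\sim\pi_0(\cdot|\xi_i)}\Big[e^{\frac{f(\theta,\zeta)-\lambda c(\xi_i,\zeta)}{\beta}}\Big].$$ (Under the assumptions both are finite in a neighbourhood of $\Theta\times\Lambda$.) With the Euclidean norm on $\mathbb R^{p}\times\mathbb R$, let $$\partial^cF(w)=\mathrm{conv}\{v:\ \exists\,w_k\to w,\ F\text{ differentiable at each }w_k,\ \nabla F(w_k)\to v\}$$ be the Clarke subdifferential, and for $\epsilon>0$ let $$[\partial^cF]^\epsilon(w)=\{v:\ \exists\,w',\ \exists\,v'\in\partial^cF(w'),\ \|v-v'\|\le\epsilon,\ \|w-w'\|\le\epsilon\}$$ be its graph enlargement. **Proposition (uniform gradient consistency).** For every $\epsilon>0$ there is $\beta_\epsilon>0$ such that for all $\beta\in(0,\beta_\epsilon]$ and all $(\theta,\lambda)\in\Theta\times\Lambda$, $F^\beta$ is differentiable at $(\theta,\lambda)$ and $$\nabla F^\beta(\theta,\lambda)\in[\partial^cF]^\epsilon(\theta,\lambda).$$ -/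

import Mathlib

open Set Filter Topology MeasureTheory

noncomputable section

namespace WDRO

/-- The sample space `ℝ^d × {1, …, J}` (Euclidean times discrete topology, Borel sets). -/
abbrev Sample (d J : ℕ) : Type := EuclideanSpace ℝ (Fin d) × Fin J

/-- The space `ℝ^p × ℝ` of pairs `(θ, t)`, with the Euclidean norm and inner product.
The scalar `t` is the dual multiplier. -/
abbrev Param (p : ℕ) : Type := WithLp 2 (EuclideanSpace ℝ (Fin p) × ℝ)

/-- A continuous function all of whose sublevel sets are compact. -/
def IsCoerciveFun {X : Type*} [TopologicalSpace X] (ψ : X → ℝ) : Prop :=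
  Continuous ψ ∧ ∀ a : ℝ, IsCompact {x | ψ x ≤ a}

/-- The slice `A ↦ π (A × {y})` of a measure on `ℝ^d × {1, …, J}`. -/
def slice {d J : ℕ} (π : Measure (Sample d J)) (y : Fin J) :
    Measure (EuclideanSpace ℝ (Fin d)) :=
  (π.restrict (Prod.snd ⁻¹' {y})).map Prod.fst

/-- The standing assumptions on the loss `f`, the cost `c` and the reference distributions
`π₀ ξ`, where `lam ξ` is the growth constant attached to `ξ` and the bounds on `f` are required
for the parameters in the set `T`. -/
structure Assumptions {p d J : ℕ} (T : Set (EuclideanSpace ℝ (Fin p)))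
    (f : EuclideanSpace ℝ (Fin p) → Sample d J → ℝ)
    (c : Sample d J → Sample d J → ℝ)
    (π₀ : Sample d J → ProbabilityMeasure (Sample d J))
    (lam : Sample d J → ℝ) : Prop where
  smooth : ∀ y : Fin J,
    Differentiable ℝ (fun z : EuclideanSpace ℝ (Fin p) × EuclideanSpace ℝ (Fin d) =>
      f z.1 (z.2, y)) ∧
    Continuous (fderiv ℝ (fun z : EuclideanSpace ℝ (Fin p) × EuclideanSpace ℝ (Fin d) =>
      f z.1 (z.2, y)))
  cost_nonneg : ∀ ξ ζ, 0 ≤ c ξ ζ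
  cost_continuous : Continuous (fun q : Sample d J × Sample d J => c q.1 q.2)
  cost_self : ∀ ξ, c ξ ξ = 0
  cost_coercive : ∀ ξ, IsCoerciveFun (c ξ)
  lam_nonneg : ∀ ξ, 0 ≤ lam ξ
  growth : ∀ ξ, ∃ μ : ℝ, ∀ θ ∈ T, ∀ ζ, f θ ζ ≤ μ + lam ξ / 2 * c ξ ζ
  reference_null : ∀ ξ, ∀ y : Fin J,
    (volume : Measure (EuclideanSpace ℝ (Fin d))) ≪ slice (π₀ ξ : Measure (Sample d J)) y
  reference_moments : ∃ a : ℝ, 0 < a ∧ ∃ ψ : Sample d J → ℝ, IsCoerciveFun ψ ∧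
    (∀ ξ, Integrable (fun ζ => c ξ ζ ^ (1 + a)) (π₀ ξ : Measure (Sample d J))) ∧
    (∀ ζ, ∀ θ ∈ T, ‖gradient (fun θ' => f θ' ζ) θ‖ < ψ ζ) ∧
    (∀ ξ, Integrable (fun ζ => ψ ζ ^ (1 + a)) (π₀ ξ : Measure (Sample d J)))

/-- `φ_ξ(θ, t) = sup_ζ (f(θ, ζ) - t c(ξ, ζ))`. -/
def dualFun {p d J : ℕ} (f : EuclideanSpace ℝ (Fin p) → Sample d J → ℝ)
    (c : Sample d J → Sample d J → ℝ) (ξ : Sample d J) (w : Param p) : ℝ :=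
  ⨆ ζ : Sample d J, (f w.fst ζ - w.snd * c ξ ζ)

/-- `φ^β_ξ(θ, t) = β log E_{ζ ∼ π₀(·|ξ)} exp ((f(θ, ζ) - t c(ξ, ζ)) / β)`. -/
def smoothDualFun {p d J : ℕ} (f : EuclideanSpace ℝ (Fin p) → Sample d J → ℝ)
    (c : Sample d J → Sample d J → ℝ)
    (π₀ : Sample d J → ProbabilityMeasure (Sample d J)) (β : ℝ)
    (ξ : Sample d J) (w : Param p) : ℝ :=
  β * Real.log (∫ ζ, Real.exp ((f w.fst ζ - w.snd * c ξ ζ) / β) ∂(π₀ ξ : Measure (Sample d J)))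

/-- `F(θ, t) = t ρ + (1/n) ∑ᵢ φ_{ξᵢ}(θ, t)`. -/
def objective {p d J n : ℕ} (ρ : ℝ) (f : EuclideanSpace ℝ (Fin p) → Sample d J → ℝ)
    (c : Sample d J → Sample d J → ℝ) (ξ : Fin n → Sample d J) (w : Param p) : ℝ :=
  w.snd * ρ + (n : ℝ)⁻¹ * ∑ i, dualFun f c (ξ i) w

/-- `F^β(θ, t) = t ρ + (1/n) ∑ᵢ φ^β_{ξᵢ}(θ, t)`. -/
def smoothObjective {p d J n : ℕ} (ρ : ℝ) (f : EuclideanSpace ℝ (Fin p) → Sample d J → ℝ)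
    (c : Sample d J → Sample d J → ℝ)
    (π₀ : Sample d J → ProbabilityMeasure (Sample d J)) (ξ : Fin n → Sample d J)
    (β : ℝ) (w : Param p) : ℝ :=
  w.snd * ρ + (n : ℝ)⁻¹ * ∑ i, smoothDualFun f c π₀ β (ξ i) w

/-- The interval `⋂ᵢ [lam ξᵢ, lamMax]` of multipliers. -/
def multipliers {d J n : ℕ} (lam : Sample d J → ℝ) (lamMax : ℝ) (ξ : Fin n → Sample d J) :
    Set ℝ :=
  ⋂ i, Icc (lam (ξ i)) lamMax

/-- The Clarke subdifferential: the convex hull of the limits of gradients taken along sequences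
of points of differentiability that converge to `x`. -/
def clarkeSubdiff {H : Type*} [NormedAddCommGroup H] [InnerProductSpace ℝ H] [CompleteSpace H]
    (g : H → ℝ) (x : H) : Set H :=
  convexHull ℝ {v | ∃ w : ℕ → H, (∀ k, DifferentiableAt ℝ g (w k)) ∧
    Tendsto w atTop (𝓝 x) ∧ Tendsto (fun k => gradient g (w k)) atTop (𝓝 v)}

/-- The `δ`-enlargement of the graph of a set-valued map. -/
def enlargement {H : Type*} [NormedAddCommGroup H] (D : H → Set H) (δ : ℝ) (w : H) : Set H :=
  {v | ∃ v' w', v' ∈ D w' ∧ ‖v - v'‖ ≤ δ ∧ ‖w - w'‖ ≤ δ}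

end WDRO

end

/-! Write `g w ζ = f(θ, ζ) - t c(ξ, ζ)` with `w = (θ, t)`. The gradient of a smoothed term is the
average of `∇g w ζ` under the Gibbs weights `exp (g w ζ / β)`. As `β → 0` and `w → w₀` jointly,
coercivity and full support of the reference measure concentrate these weights near the maximisers
of `g w₀` (`CoerciveNear.eventually_integral_exp_mul_le`). Hence in each direction `e` the upper
limit of the smoothed derivative is at most the largest derivative along `e` among active functions.

Conversely, `F` is locally a maximum of `C¹` functions indexed by tuples `(ζᵢ)`. By Rademacher, `w₀`
can be approached asymptotically along `e` through points of differentiability, and some limit of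
gradients there dominates every active gradient in the direction `e`
(`IsMaxNear.exists_mem_limitGradients`). So the support function of the Clarke subdifferential
bounds the smoothed gradients asymptotically. Hahn–Banach, together with a local bound on these
gradients, puts them in its `ε`-thickening (`eventually_gradient_mem_thickening`). Compactness of `Θ
× Λ` makes the threshold for `β` uniform; the graph enlargement absorbs the passage from `w` to a
nearby `w₀`. -/

noncomputable section

set_option linter.unusedSectionVars false

namespace WDRO

/-! ### Maxima of `C¹` functions and limits of their gradients -/

section MaxFunction

variable {H Z : Type*} [NormedAddCommGroup H] [InnerProductSpace ℝ H] [CompleteSpace H]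
  [TopologicalSpace Z]

/-- Near `w₀`, the function `F` is the pointwise maximum of the functions `G · ζ`, and the maximum
is attained in the compact set `B`. -/
structure IsMaxNear (F : H → ℝ) (G : H → Z → ℝ) (B : Set Z) (w₀ : H) : Prop where
  isCompact : IsCompact B
  le : ∀ᶠ w in 𝓝 w₀, ∀ ζ, G w ζ ≤ F w
  attained : ∀ᶠ w in 𝓝 w₀, ∃ ζ ∈ B, G w ζ = F w

/-- The limits of gradients of `g` along sequences converging to `x`. -/
def limitGradients (g : H → ℝ) (x : H) : Set H :=
  {v | ∃ w : ℕ → H, (∀ k, DifferentiableAt ℝ g (w k)) ∧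
    Tendsto w atTop (𝓝 x) ∧ Tendsto (fun k => gradient g (w k)) atTop (𝓝 v)}

variable {F : H → ℝ} {G : H → Z → ℝ} {DG : H → Z → H} {B : Set Z} {w₀ : H}

theorem mean_value_gradient (hG : ∀ w ζ, HasGradientAt (fun w => G w ζ) (DG w ζ) w)
    (w₀ w : H) (ζ : Z) :
    ∃ z, dist z w₀ ≤ dist w w₀ ∧ G w ζ - G w₀ ζ = inner ℝ (DG z ζ) (w - w₀) := by
  obtain ⟨z, hz, h⟩ := domain_mvt (f := fun w => G w ζ) (s := univ) (x := w₀) (y := w)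
    (fun x _ => (hG x ζ).hasFDerivAt.hasFDerivWithinAt) convex_univ (mem_univ _) (mem_univ _)
  refine ⟨z, ?_, by simpa using h⟩
  have hs : segment ℝ w₀ w ⊆ Metric.closedBall w₀ (dist w w₀) :=
    (convex_closedBall _ _).segment_subset (Metric.mem_closedBall_self dist_nonneg)
      (Metric.mem_closedBall.2 le_rfl)
  exact Metric.mem_closedBall.1 (hs hz)

theorem eventually_norm_lt_of_isCompact (hB : IsCompact B)
    (hDG : Continuous fun q : H × Z => DG q.1 q.2) (w₀ : H) :
    ∃ K : ℝ, 0 < K ∧ ∀ᶠ w in 𝓝 w₀, ∀ ζ ∈ B, ‖DG w ζ‖ < K := by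
  obtain ⟨K, hK⟩ := hB.exists_bound_of_continuousOn (f := fun ζ => DG w₀ ζ)
    (by fun_prop : Continuous fun ζ => DG w₀ ζ).continuousOn
  refine ⟨|K| + 1, by positivity, hB.eventually_forall_of_forall_eventually fun ζ hζ => ?_⟩
  have hc : ContinuousAt (fun q : H × Z => ‖DG q.1 q.2‖) (w₀, ζ) := hDG.norm.continuousAt
  refine hc.eventually (gt_mem_nhds ?_)
  exact (hK ζ hζ).trans_lt (by linarith [le_abs_self K])

/-- A maximiser `ζ ∈ B` at `x` gives `F x - F y ≤ G x ζ - G y ζ`, and the gradients are bounded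
uniformly over the compact set `B`. -/
theorem IsMaxNear.exists_lipschitzOnWith (h : IsMaxNear F G B w₀)
    (hG : ∀ w ζ, HasGradientAt (fun w => G w ζ) (DG w ζ) w)
    (hDG : Continuous fun q : H × Z => DG q.1 q.2) :
    ∃ r > 0, ∃ K : NNReal, LipschitzOnWith K F (Metric.ball w₀ r) := by
  obtain ⟨K, hK0, hK⟩ := eventually_norm_lt_of_isCompact h.isCompact hDG w₀
  obtain ⟨r, hr, hball⟩ := Metric.eventually_nhds_iff_ball.1 (hK.and (h.le.and h.attained))
  refine ⟨r, hr, ⟨K, hK0.le⟩, LipschitzOnWith.of_le_add_mul _ fun x hx y hy => ?_⟩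
  obtain ⟨ζ, hζ, hζx⟩ := (hball x hx).2.2
  have h1 := (convex_ball w₀ r).norm_image_sub_le_of_norm_hasFDerivWithin_le
    (f := fun w => G w ζ) (C := K)
    (fun z _ => (hG z ζ).hasFDerivAt.hasFDerivWithinAt)
    (fun z hz => by simpa using ((hball z hz).1 ζ hζ).le) hy hx
  have h2 := (hball y hy).2.1 ζ
  have h3 := (Real.le_norm_self _).trans h1
  rw [← hζx, dist_eq_norm]
  change G x ζ ≤ F y + K * ‖x - y‖
  linarith

/-- Rademacher's theorem on a ball where `F` is Lipschitz; a set of full Haar measure is dense. -/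
theorem IsMaxNear.eventually_mem_closure_differentiableAt [FiniteDimensional ℝ H]
    (h : IsMaxNear F G B w₀)
    (hG : ∀ w ζ, HasGradientAt (fun w => G w ζ) (DG w ζ) w)
    (hDG : Continuous fun q : H × Z => DG q.1 q.2) :
    ∀ᶠ w in 𝓝 w₀, w ∈ closure {w | DifferentiableAt ℝ F w} := by
  obtain ⟨r, hr, K, hK⟩ := h.exists_lipschitzOnWith hG hDG
  borelize H
  have hae := hK.ae_differentiableWithinAt_of_mem (μ := Measure.addHaar)
  filter_upwards [Metric.ball_mem_nhds w₀ hr] with w hw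
  refine mem_closure_iff.2 fun o ho hwo => ?_
  have hd : Dense {x | x ∈ Metric.ball w₀ r → DifferentiableWithinAt ℝ F (Metric.ball w₀ r) x} :=
    Measure.dense_of_ae hae
  obtain ⟨x, hx, hxd⟩ := hd.inter_open_nonempty _ (ho.inter Metric.isOpen_ball) ⟨w, hwo, hw⟩
  exact ⟨x, hx.1, (hxd hx.2).differentiableAt (Metric.isOpen_ball.mem_nhds hx.2)⟩

/-- The difference `F - G · ζ` has a local minimum at `w`. -/
theorem gradient_eq_of_isMax {w : H} {ζ : Z} (hle : ∀ᶠ w' in 𝓝 w, G w' ζ ≤ F w')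
    (heq : G w ζ = F w) (hG : HasGradientAt (fun w => G w ζ) (DG w ζ) w)
    (hF : DifferentiableAt ℝ F w) : gradient F w = DG w ζ := by
  have hmin : IsLocalMin (fun w' => F w' - G w' ζ) w := by
    filter_upwards [hle] with w' hw'
    rw [heq]
    linarith
  have h0 := hmin.hasFDerivAt_eq_zero (hF.hasGradientAt.hasFDerivAt.sub hG.hasFDerivAt)
  rw [sub_eq_zero] at h0
  exact (InnerProductSpace.toDual ℝ H).injective h0

/-- The limits of gradients of a maximum of `C¹` functions dominate, in each direction, the
gradients of all the functions that are active at the limit point. -/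
theorem IsMaxNear.exists_mem_limitGradients [FiniteDimensional ℝ H] [FirstCountableTopology Z]
    (h : IsMaxNear F G B w₀)
    (hG : ∀ w ζ, HasGradientAt (fun w => G w ζ) (DG w ζ) w)
    (hDG : Continuous fun q : H × Z => DG q.1 q.2) (e : H) :
    ∃ v ∈ limitGradients F w₀, ∀ ζ, G w₀ ζ = F w₀ → inner ℝ (DG w₀ ζ) e ≤ inner ℝ v e := by
  have hline : Tendsto (fun s : ℝ => w₀ + s • e) (𝓝[>] 0) (𝓝 w₀) := by
    have : Tendsto (fun s : ℝ => w₀ + s • e) (𝓝 0) (𝓝 (w₀ + (0 : ℝ) • e)) :=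
      (by fun_prop : Continuous fun s : ℝ => w₀ + s • e).tendsto 0
    simpa using this.mono_left nhdsWithin_le_nhds
  have hev := hline.eventually ((h.eventually_mem_closure_differentiableAt hG hDG).and
    (h.le.eventually_nhds.and h.attained).eventually_nhds)
  -- The error `s²` is negligible against the step `s`, so the perturbed points still approach `w₀`
  -- in the direction `e`.
  have hev' : ∀ᶠ s : ℝ in 𝓝[>] 0, ∃ w : H, ∃ ζ ∈ B, DifferentiableAt ℝ F w ∧
      dist w (w₀ + s • e) < s * s ∧ (∀ᶠ w' in 𝓝 w, ∀ ζ', G w' ζ' ≤ F w') ∧ G w ζ = F w := by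
    filter_upwards [hev, self_mem_nhdsWithin] with s hs hs0
    have hs0 : 0 < s := hs0
    obtain ⟨w, ⟨hw1, hw2⟩, hw3⟩ := mem_closure_iff_nhds.1 hs.1 _
      (inter_mem (Metric.ball_mem_nhds _ (mul_pos hs0 hs0)) hs.2)
    obtain ⟨hle, ζ, hζ, hζ'⟩ := hw2
    exact ⟨w, ζ, hζ, hw3, hw1, hle, hζ'⟩
  obtain ⟨δ, hδ, hIoo⟩ := mem_nhdsGT_iff_exists_Ioo_subset.1 hev'
  obtain ⟨s, -, hsmem, hs0⟩ := exists_seq_strictAnti_tendsto' (mem_Ioi.1 hδ)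
  choose w ζ hζB hdiff hdist hle heq using fun k => hIoo (hsmem k)
  obtain ⟨ζ', -, φ, hφ, hζ'⟩ := h.isCompact.tendsto_subseq hζB
  have hspos : ∀ k, 0 < s k := fun k => (hsmem k).1
  have hquot : Tendsto (fun k => (s k)⁻¹ • (w k - w₀)) atTop (𝓝 e) := by
    rw [tendsto_iff_dist_tendsto_zero]
    refine squeeze_zero (fun _ => dist_nonneg) (fun k => ?_) hs0
    have : (s k)⁻¹ • (w k - w₀) - e = (s k)⁻¹ • (w k - (w₀ + s k • e)) := by
      rw [← sub_sub, smul_sub _ (w k - w₀), smul_smul, inv_mul_cancel₀ (hspos k).ne', one_smul]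
    rw [dist_eq_norm, this, norm_smul, norm_inv, Real.norm_of_nonneg (hspos k).le,
      inv_mul_le_iff₀ (hspos k), ← dist_eq_norm]
    exact (hdist k).le
  have hw : Tendsto w atTop (𝓝 w₀) := by
    have h1 : Tendsto (fun k => w₀ + s k • ((s k)⁻¹ • (w k - w₀))) atTop
        (𝓝 (w₀ + (0 : ℝ) • e)) := tendsto_const_nhds.add (hs0.smul hquot)
    rw [zero_smul, add_zero] at h1
    refine h1.congr fun k => ?_
    rw [smul_smul, mul_inv_cancel₀ (hspos k).ne', one_smul, add_sub_cancel]
  have hwφ := hw.comp hφ.tendsto_atTop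
  -- The points `z k` will be the intermediate points of the mean value theorem, once for a fixed
  -- active index and once for the maximisers.
  have hlim : ∀ (z : ℕ → H) (η : ℕ → Z) (η' : Z), (∀ k, dist (z k) w₀ ≤ dist (w (φ k)) w₀) →
      Tendsto η atTop (𝓝 η') → Tendsto (fun k => inner ℝ (DG (z k) (η k))
        ((s (φ k))⁻¹ • (w (φ k) - w₀))) atTop (𝓝 (inner ℝ (DG w₀ η') e)) := by
    intro z η η' hz hη
    have hz' : Tendsto z atTop (𝓝 w₀) := by
      rw [tendsto_iff_dist_tendsto_zero] at hwφ ⊢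
      exact squeeze_zero (fun _ => dist_nonneg) hz hwφ
    have h1 : Tendsto (fun k => DG (z k) (η k)) atTop (𝓝 (DG w₀ η')) :=
      (hDG.tendsto (w₀, η')).comp (hz'.prodMk_nhds hη)
    exact h1.inner (hquot.comp hφ.tendsto_atTop)
  refine ⟨DG w₀ ζ', ⟨w ∘ φ, fun k => hdiff _, hwφ, ?_⟩, fun η hη => ?_⟩
  · have h1 : Tendsto (fun k => DG (w (φ k)) (ζ (φ k))) atTop (𝓝 (DG w₀ ζ')) :=
      (hDG.tendsto (w₀, ζ')).comp (hwφ.prodMk_nhds hζ')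
    refine h1.congr fun k => ?_
    exact (gradient_eq_of_isMax ((hle _).mono fun w' hw' => hw' _) (heq _) (hG _ _)
      (hdiff _)).symm
  · choose y hy hy' using fun k => mean_value_gradient hG w₀ (w (φ k)) η
    choose z hz hz' using fun k => mean_value_gradient hG w₀ (w (φ k)) (ζ (φ k))
    refine le_of_tendsto_of_tendsto' (hlim y (fun _ => η) η hy tendsto_const_nhds)
      (hlim z _ ζ' hz hζ') fun k => ?_
    -- It remains to compare increments from `w₀` to `w`: `η` is active at `w₀` and `ζ` at `w`, so
    -- the increment of `G · η` is at most that of `G · ζ`.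
    rw [inner_smul_right, inner_smul_right, ← hy', Function.comp_apply, ← hz']
    refine mul_le_mul_of_nonneg_left ?_ (inv_nonneg.2 (hspos _).le)
    have h1 := (hle (φ k)).self_of_nhds η
    have h2 := h.le.self_of_nhds (ζ (φ k))
    have h3 := heq (φ k)
    linarith

end MaxFunction

/-! ### Coercivity and the Laplace principle -/

section Laplace

variable {H Z : Type*} [NormedAddCommGroup H] [TopologicalSpace Z]

/-- The superlevel sets of `g w` are contained in a compact set, uniformly for `w` near `w₀`. -/
def CoerciveNear (g : H → Z → ℝ) (w₀ : H) : Prop :=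
  ∀ R : ℝ, ∃ B : Set Z, IsCompact B ∧ ∀ᶠ w in 𝓝 w₀, ∀ ζ ∉ B, g w ζ ≤ R

variable {g : H → Z → ℝ} {w₀ : H}

theorem CoerciveNear.exists_isMaxOn [Nonempty Z] (h : CoerciveNear g w₀)
    (hg : Continuous fun q : H × Z => g q.1 q.2) :
    ∃ B : Set Z, IsCompact B ∧ ∀ᶠ w in 𝓝 w₀, ∃ ζ ∈ B, ∀ ζ', g w ζ' ≤ g w ζ := by
  obtain ⟨ζ₁⟩ := ‹Nonempty Z›
  -- Near `w₀` the value at `ζ₁` stays above this level, so no point outside `B` can beat `ζ₁`.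
  obtain ⟨B, hB, hev⟩ := h (g w₀ ζ₁ - 1)
  refine ⟨B, hB, ?_⟩
  have h1 : ∀ᶠ w in 𝓝 w₀, g w₀ ζ₁ - 1 < g w ζ₁ :=
    (by fun_prop : Continuous fun w => g w ζ₁).continuousAt.eventually
      (lt_mem_nhds (sub_one_lt _))
  filter_upwards [hev, h1] with w hw hw1
  have hζ₁ : ζ₁ ∈ B := by
    by_contra hn
    exact (hw ζ₁ hn).not_gt hw1
  obtain ⟨ζ, hζ, hmax⟩ := hB.exists_isMaxOn ⟨ζ₁, hζ₁⟩
    (by fun_prop : Continuous fun ζ => g w ζ).continuousOn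
  refine ⟨ζ, hζ, fun ζ' => ?_⟩
  by_cases hζ' : ζ' ∈ B
  · exact hmax hζ'
  · exact (hw ζ' hζ').trans (hw1.le.trans (hmax hζ₁))

/-- Compactness turns the pointwise strict inequality `g w₀ ζ < M` into a gap `η` uniform in `ζ` and
in `w` near `w₀`; outside a compact set coercivity gives the gap `1`. -/
theorem CoerciveNear.exists_gap {q : H → Z → ℝ} {M m : ℝ} (h : CoerciveNear g w₀)
    (hg : Continuous fun q : H × Z => g q.1 q.2) (hq : Continuous fun x : H × Z => q x.1 x.2)
    (hm : ∀ ζ, g w₀ ζ < M ∨ q w₀ ζ < m) :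
    ∃ η > 0, ∀ᶠ w in 𝓝 w₀, ∀ ζ, g w ζ ≤ M - η ∨ q w ζ < m := by
  obtain ⟨B, hB, hev⟩ := h (M - 1)
  have key : ∃ η > 0, ∀ᶠ w in 𝓝 w₀, ∀ ζ ∈ B, g w ζ ≤ M - η ∨ q w ζ < m := by
    refine hB.induction_on (p := fun S => ∃ η > 0, ∀ᶠ w in 𝓝 w₀, ∀ ζ ∈ S,
      g w ζ ≤ M - η ∨ q w ζ < m) ⟨1, one_pos, by simp⟩ ?_ ?_ ?_
    · rintro s t hst ⟨η, hη, ht⟩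
      exact ⟨η, hη, ht.mono fun w hw ζ hζ => hw ζ (hst hζ)⟩
    · rintro s t ⟨η, hη, hs⟩ ⟨η', hη', ht⟩
      refine ⟨min η η', lt_min hη hη', ?_⟩
      filter_upwards [hs, ht] with w hws hwt ζ hζ
      rcases hζ with hζ | hζ
      · exact (hws ζ hζ).imp_left fun h => h.trans (by linarith [min_le_left η η'])
      · exact (hwt ζ hζ).imp_left fun h => h.trans (by linarith [min_le_right η η'])
    · intro ζ _
      rcases hm ζ with hζ | hζ
      · have h1 : ∀ᶠ x in 𝓝 w₀ ×ˢ 𝓝 ζ, g x.1 x.2 < (M + g w₀ ζ) / 2 := by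
          rw [← nhds_prod_eq]
          exact hg.continuousAt.eventually (gt_mem_nhds (by change g w₀ ζ < _; linarith))
        obtain ⟨p, hp, p', hp', hpp⟩ := eventually_prod_iff.1 h1
        refine ⟨{ζ | p' ζ}, mem_nhdsWithin_of_mem_nhds hp', (M - g w₀ ζ) / 2, by linarith, ?_⟩
        filter_upwards [hp] with w hw ζ' hζ'
        exact Or.inl (by linarith [hpp hw hζ'])
      · have h1 : ∀ᶠ x in 𝓝 w₀ ×ˢ 𝓝 ζ, q x.1 x.2 < m := by
          rw [← nhds_prod_eq]
          exact hq.continuousAt.eventually (gt_mem_nhds hζ)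
        obtain ⟨p, hp, p', hp', hpp⟩ := eventually_prod_iff.1 h1
        refine ⟨{ζ | p' ζ}, mem_nhdsWithin_of_mem_nhds hp', 1, one_pos, ?_⟩
        filter_upwards [hp] with w hw ζ' hζ'
        exact Or.inr (hpp hw hζ')
  obtain ⟨η, hη, hBη⟩ := key
  refine ⟨min η 1, lt_min hη one_pos, ?_⟩
  filter_upwards [hev, hBη] with w hw hwB ζ
  by_cases hζ : ζ ∈ B
  · exact (hwB ζ hζ).imp_left fun h => h.trans (by linarith [min_le_left η 1])
  · exact Or.inl ((hw ζ hζ).trans (by linarith [min_le_right η 1]))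

variable [MeasurableSpace Z] [OpensMeasurableSpace Z] {π : Measure Z}

theorem integrable_exp_mul {u q Φ : Z → ℝ} {μ β : ℝ} (hβ : 0 < β) (hu : Continuous u)
    (hq : Continuous q) (hμ : ∀ ζ, u ζ ≤ μ) (hΦ : Integrable Φ π) (hqΦ : ∀ ζ, |q ζ| ≤ Φ ζ) :
    Integrable (fun ζ => Real.exp (u ζ / β) * q ζ) π := by
  refine (hΦ.const_mul (Real.exp (μ / β))).mono'
    (by fun_prop : Continuous fun ζ => Real.exp (u ζ / β) * q ζ).measurable.aestronglyMeasurable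
    (ae_of_all _ fun ζ => ?_)
  rw [norm_mul, Real.norm_of_nonneg (Real.exp_pos _).le]
  exact mul_le_mul (Real.exp_le_exp.2 (div_le_div_of_nonneg_right (hμ ζ) hβ.le)) (hqΦ ζ)
    (norm_nonneg _) (Real.exp_pos _).le

theorem integrable_exp_div [IsFiniteMeasure π] {u : Z → ℝ} {μ β : ℝ} (hβ : 0 < β)
    (hu : Continuous u) (hμ : ∀ ζ, u ζ ≤ μ) : Integrable (fun ζ => Real.exp (u ζ / β)) π := by
  simpa using integrable_exp_mul (q := fun _ => 1) (Φ := fun _ => 1) hβ hu continuous_const hμ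
    (integrable_const _) (by simp)

/-- Laplace principle: as `β → 0` and `w → w₀`, the Gibbs averages of `q w` are asymptotically at
most the supremum of `q w₀` over the maximisers of `g w₀`. -/
theorem CoerciveNear.eventually_integral_exp_mul_le [IsFiniteMeasure π] [π.IsOpenPosMeasure]
    {q : H → Z → ℝ} {Φ : Z → ℝ} {ζ₀ : Z} {μ m δ : ℝ} (h : CoerciveNear g w₀)
    (hg : Continuous fun q : H × Z => g q.1 q.2) (hq : Continuous fun x : H × Z => q x.1 x.2)
    (hμ : ∀ᶠ w in 𝓝 w₀, ∀ ζ, g w ζ ≤ μ) (hΦ : Integrable Φ π)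
    (hqΦ : ∀ᶠ w in 𝓝 w₀, ∀ ζ, |q w ζ| ≤ Φ ζ)
    (hm : ∀ ζ, g w₀ ζ < g w₀ ζ₀ ∨ q w₀ ζ < m) (hδ : 0 < δ) :
    ∀ᶠ x : ℝ × H in 𝓝[>] 0 ×ˢ 𝓝 w₀, ∫ ζ, Real.exp (g x.2 ζ / x.1) * q x.2 ζ ∂π ≤
      (m + δ) * ∫ ζ, Real.exp (g x.2 ζ / x.1) ∂π := by
  obtain ⟨η, hη, hgap⟩ := h.exists_gap hg hq hm
  set M := g w₀ ζ₀ with hM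
  -- Half of the gap is kept: the bad region contributes at most `exp ((M - η) / β) * C`, while the
  -- normalising integral is at least `π.real V * exp ((M - η / 2) / β)`. The quotient decays like
  -- `exp (-η / (2β))`.
  have h1 : ∀ᶠ x in 𝓝 w₀ ×ˢ 𝓝 ζ₀, M - η / 2 < g x.1 x.2 := by
    rw [← nhds_prod_eq]
    exact hg.continuousAt.eventually (lt_mem_nhds (by change M - η / 2 < g w₀ ζ₀; linarith))
  obtain ⟨p, hp, p', hp', hpp⟩ := eventually_prod_iff.1 h1
  obtain ⟨V, hVp, hVo, hζV⟩ := mem_nhds_iff.1 hp'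
  have hπV : 0 < π.real V :=
    ENNReal.toReal_pos (hVo.measure_pos π ⟨ζ₀, hζV⟩).ne' (measure_ne_top _ _)
  set C := ∫ ζ, (Φ ζ + |m|) ∂π with hC
  have hlim : Tendsto (fun β : ℝ => Real.exp (-(η / 2 / β)) * C) (𝓝[>] 0) (𝓝 (0 * C)) := by
    refine Tendsto.mul_const _ (Real.tendsto_exp_neg_atTop_nhds_zero.comp ?_)
    exact (tendsto_inv_nhdsGT_zero.const_mul_atTop (half_pos hη)).congr fun β =>
      (div_eq_mul_inv _ _).symm
  have hsmall : ∀ᶠ β : ℝ in 𝓝[>] 0, Real.exp (-(η / 2 / β)) * C < δ * π.real V :=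
    hlim.eventually (gt_mem_nhds (by rw [zero_mul]; positivity))
  have hβ : ∀ᶠ β : ℝ in 𝓝[>] 0, 0 < β := self_mem_nhdsWithin
  filter_upwards [(hβ.and hsmall).prod_mk (hgap.and (hp.and (hμ.and hqΦ)))]
  rintro ⟨β, w⟩ ⟨⟨hβ, hsmall⟩, hgap, hp, hμ, hqΦ⟩
  simp only at *
  have hgw : Continuous fun ζ => g w ζ := by fun_prop
  have hqw : Continuous fun ζ => q w ζ := by fun_prop
  have hi1 : Integrable (fun ζ => Real.exp (g w ζ / β)) π := integrable_exp_div hβ hgw hμ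
  have hi2 : Integrable (fun ζ => Real.exp (g w ζ / β) * q w ζ) π :=
    integrable_exp_mul hβ hgw hqw hμ hΦ hqΦ
  have hΦm : Integrable (fun ζ => Φ ζ + |m|) π := hΦ.add (integrable_const _)
  have hup : ∫ ζ, (Real.exp (g w ζ / β) * q w ζ - m * Real.exp (g w ζ / β)) ∂π ≤
      ∫ ζ, Real.exp ((M - η) / β) * (Φ ζ + |m|) ∂π := by
    refine integral_mono (hi2.sub (hi1.const_mul m)) (hΦm.const_mul _) fun ζ => ?_
    have hpos : 0 ≤ Φ ζ + |m| := add_nonneg ((abs_nonneg _).trans (hqΦ ζ)) (abs_nonneg _)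
    have he := Real.exp_pos (g w ζ / β)
    have hfac : Real.exp (g w ζ / β) * q w ζ - m * Real.exp (g w ζ / β) =
      Real.exp (g w ζ / β) * (q w ζ - m) := by ring
    simp only [hfac]
    -- Either the exponential is small and `Φ + |m|` dominates the other factor, or `q w ζ < m` and
    -- the integrand is nonpositive.
    rcases hgap ζ with hζ | hζ
    · calc Real.exp (g w ζ / β) * (q w ζ - m) ≤ Real.exp (g w ζ / β) * (Φ ζ + |m|) := by
            refine mul_le_mul_of_nonneg_left ?_ he.le
            linarith [le_abs_self (q w ζ), hqΦ ζ, neg_abs_le m]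
        _ ≤ _ := mul_le_mul_of_nonneg_right
            (Real.exp_le_exp.2 (div_le_div_of_nonneg_right hζ hβ.le)) hpos
    · exact (mul_nonpos_of_nonneg_of_nonpos he.le (by linarith)).trans
        (mul_nonneg (Real.exp_pos _).le hpos)
  have hlow : π.real V * Real.exp ((M - η / 2) / β) ≤ ∫ ζ, Real.exp (g w ζ / β) ∂π := by
    calc π.real V * Real.exp ((M - η / 2) / β)
        = ∫ ζ in V, Real.exp ((M - η / 2) / β) ∂π := by simp
      _ ≤ ∫ ζ in V, Real.exp (g w ζ / β) ∂π :=
          setIntegral_mono_on (integrable_const _).integrableOn hi1.integrableOn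
            hVo.measurableSet fun ζ hζ =>
              Real.exp_le_exp.2 (div_le_div_of_nonneg_right (hpp hp (hVp hζ)).le hβ.le)
      _ ≤ _ := setIntegral_le_integral hi1 (ae_of_all _ fun ζ => (Real.exp_pos _).le)
  rw [integral_sub hi2 (hi1.const_mul m), integral_const_mul, integral_const_mul, ← hC] at hup
  have hexp : Real.exp ((M - η) / β) =
      Real.exp ((M - η / 2) / β) * Real.exp (-(η / 2 / β)) := by
    rw [← Real.exp_add]
    congr 1
    ring
  have h2 : Real.exp ((M - η) / β) * C ≤ δ * ∫ ζ, Real.exp (g w ζ / β) ∂π := by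
    calc Real.exp ((M - η) / β) * C
        = Real.exp ((M - η / 2) / β) * (Real.exp (-(η / 2 / β)) * C) := by rw [hexp, mul_assoc]
      _ ≤ Real.exp ((M - η / 2) / β) * (δ * π.real V) :=
          mul_le_mul_of_nonneg_left hsmall.le (Real.exp_pos _).le
      _ = δ * (π.real V * Real.exp ((M - η / 2) / β)) := by ring
      _ ≤ _ := mul_le_mul_of_nonneg_left hlow hδ.le
  linarith

end Laplace

/-! ### Differentiating the log-integral -/

section SmoothMax

variable {H Z : Type*} [NormedAddCommGroup H] [InnerProductSpace ℝ H] [CompleteSpace H]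
  [TopologicalSpace Z] [SecondCountableTopology Z] [MeasurableSpace Z] [OpensMeasurableSpace Z] {π : Measure Z}
  {g : H → Z → ℝ} {Dg : H → Z → H} {w₀ : H} {Φ : Z → ℝ} {μ β : ℝ}

/-- Differentiation under the integral, dominated by `exp (μ / β) * β⁻¹ * Φ`. The factor `β` cancels
the `β⁻¹` from the exponent, leaving a Gibbs average of `Dg`. -/
theorem hasGradientAt_mul_log_integral_exp [IsProbabilityMeasure π] (hβ : 0 < β)
    (hg : Continuous fun q : H × Z => g q.1 q.2)
    (hDg : Continuous fun q : H × Z => Dg q.1 q.2)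
    (hgrad : ∀ w ζ, HasGradientAt (fun w => g w ζ) (Dg w ζ) w)
    (hμ : ∀ᶠ w in 𝓝 w₀, ∀ ζ, g w ζ ≤ μ) (hΦ : Integrable Φ π)
    (hDgΦ : ∀ᶠ w in 𝓝 w₀, ∀ ζ, ‖Dg w ζ‖ ≤ Φ ζ) :
    DifferentiableAt ℝ (fun w => β * Real.log (∫ ζ, Real.exp (g w ζ / β) ∂π)) w₀ ∧
    ∀ e, inner ℝ (gradient (fun w => β * Real.log (∫ ζ, Real.exp (g w ζ / β) ∂π)) w₀) e =
      (∫ ζ, Real.exp (g w₀ ζ / β) ∂π)⁻¹ *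
        ∫ ζ, Real.exp (g w₀ ζ / β) * inner ℝ (Dg w₀ ζ) e ∂π := by
  have hμ₀ := hμ.self_of_nhds
  have hΦ₀ := hDgΦ.self_of_nhds
  have hcont : ∀ w, Continuous fun ζ => g w ζ := fun w => by fun_prop
  have hi : Integrable (fun ζ => Real.exp (g w₀ ζ / β)) π := integrable_exp_div hβ (hcont _) hμ₀
  have hpos : 0 < ∫ ζ, Real.exp (g w₀ ζ / β) ∂π := integral_exp_pos hi
  set F' : H → Z → H →L[ℝ] ℝ := fun w ζ =>
    (Real.exp (g w ζ / β) * β⁻¹) • innerSL ℝ (Dg w ζ) with hF'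
  have hF'cont : Continuous fun ζ => F' w₀ ζ := by
    have : Continuous fun ζ => Dg w₀ ζ := by fun_prop
    have := (innerSL (E := H) ℝ).continuous.comp this
    have := hcont w₀
    fun_prop
  have hbound : ∀ w, (∀ ζ, g w ζ ≤ μ) → (∀ ζ, ‖Dg w ζ‖ ≤ Φ ζ) → ∀ ζ,
      ‖F' w ζ‖ ≤ Real.exp (μ / β) * β⁻¹ * Φ ζ := by
    intro w hw1 hw2 ζ
    rw [hF', norm_smul, innerSL_apply_norm, Real.norm_of_nonneg (by positivity)]
    refine mul_le_mul (mul_le_mul_of_nonneg_right (Real.exp_le_exp.2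
      (div_le_div_of_nonneg_right (hw1 ζ) hβ.le)) (inv_nonneg.2 hβ.le)) (hw2 ζ) (norm_nonneg _)
      (by positivity)
  have hbint : Integrable (fun ζ => Real.exp (μ / β) * β⁻¹ * Φ ζ) π := hΦ.const_mul _
  have hmeas : AEStronglyMeasurable (F' w₀) π := hF'cont.aestronglyMeasurable
  have hderiv : HasFDerivAt (fun w => ∫ ζ, Real.exp (g w ζ / β) ∂π) (∫ ζ, F' w₀ ζ ∂π) w₀ := by
    refine hasFDerivAt_integral_of_dominated_of_fderiv_le (hμ.and hDgΦ)
      (Eventually.of_forall fun w => ?_) hi hmeas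
      (ae_of_all _ fun ζ w hw => hbound w hw.1 hw.2 ζ) hbint (ae_of_all _ fun ζ w _ => ?_)
    · have := hcont w
      exact (by fun_prop : Continuous fun ζ => Real.exp (g w ζ / β)).measurable.aestronglyMeasurable
    · have h0 : HasFDerivAt (fun w => g w ζ) (innerSL ℝ (Dg w ζ)) w := (hgrad w ζ).hasFDerivAt
      have h1 := (h0.mul_const β⁻¹).exp
      simp only [← div_eq_mul_inv, smul_smul] at h1
      exact h1
  have hlog := (hderiv.log hpos.ne').const_mul β
  refine ⟨hlog.differentiableAt, fun e => ?_⟩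
  have hF'int : Integrable (F' w₀) π :=
    hbint.mono' hmeas (ae_of_all _ (hbound w₀ hμ₀ hΦ₀))
  have hint : (∫ ζ, F' w₀ ζ ∂π) e =
      β⁻¹ * ∫ ζ, Real.exp (g w₀ ζ / β) * inner ℝ (Dg w₀ ζ) e ∂π := by
    rw [ContinuousLinearMap.integral_apply hF'int, ← integral_const_mul]
    refine integral_congr_ae (ae_of_all _ fun ζ => ?_)
    simp [hF']
    ring
  rw [← InnerProductSpace.toDual_apply_apply, toDual_gradient, hlog.fderiv]
  simp only [smul_apply, smul_eq_mul, hint]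
  field_simp

end SmoothMax

/-! ### Asymptotics of the smoothed gradients -/

section Consistency

variable {H Z : Type*} [NormedAddCommGroup H] [InnerProductSpace ℝ H] [CompleteSpace H]
  [TopologicalSpace Z] [SecondCountableTopology Z] [MeasurableSpace Z] [OpensMeasurableSpace Z]

/-- Conditions near `w₀` under which `w ↦ sup_ζ g w ζ` can be smoothed by log-integrals with
respect to `π`. -/
structure IsSmoothable (π : Measure Z) (g : H → Z → ℝ) (Dg : H → Z → H) (w₀ : H) : Prop where
  continuous : Continuous fun q : H × Z => g q.1 q.2
  continuous_gradient : Continuous fun q : H × Z => Dg q.1 q.2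
  hasGradientAt : ∀ w ζ, HasGradientAt (fun w => g w ζ) (Dg w ζ) w
  coercive : CoerciveNear g w₀
  bounded : ∃ μ : ℝ, ∀ᶠ w in 𝓝 w₀, ∀ ζ, g w ζ ≤ μ
  gradient_bounded : ∃ Φ : Z → ℝ, Integrable Φ π ∧ ∀ᶠ w in 𝓝 w₀, ∀ ζ, ‖Dg w ζ‖ ≤ Φ ζ

/-- The smoothing `β log ∫ exp (g w ζ / β) dπ(ζ)` of `sup_ζ g w ζ`. -/
def logIntegralExp (π : Measure Z) (g : H → Z → ℝ) (β : ℝ) (w : H) : ℝ :=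
  β * Real.log (∫ ζ, Real.exp (g w ζ / β) ∂π)

variable {π : Measure Z} {g : H → Z → ℝ} {Dg : H → Z → H} {w₀ : H}

theorem hasGradientAt_inner_add_sum {ι : Type*} [Fintype ι] (r : H) (a : ℝ) {φ : ι → H → ℝ}
    {v : ι → H} {w : H} (h : ∀ i, HasGradientAt (φ i) (v i) w) :
    HasGradientAt (fun w => inner ℝ r w + a * ∑ i, φ i w) (r + a • ∑ i, v i) w := by
  have h0 : ∀ i, HasFDerivAt (φ i) (innerSL ℝ (v i)) w := fun i => (h i).hasFDerivAt
  have h1 : HasFDerivAt (fun w => inner ℝ r w + a * ∑ i, φ i w)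
      (innerSL ℝ r + a • ∑ i, innerSL ℝ (v i)) w :=
    (innerSL ℝ r).hasFDerivAt.add ((HasFDerivAt.fun_sum fun i _ => h0 i).const_mul a)
  have h2 : innerSL ℝ r + a • ∑ i, innerSL ℝ (v i) = innerSL ℝ (r + a • ∑ i, v i) := by
    ext e
    simp
  rw [h2] at h1
  exact h1

theorem IsSmoothable.isCompact_superlevel (h : IsSmoothable π g Dg w₀) (M : ℝ) :
    IsCompact {ζ | M ≤ g w₀ ζ} := by
  obtain ⟨B, hB, hev⟩ := h.coercive (M - 1)
  have hg := h.continuous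
  refine IsCompact.of_isClosed_subset hB (isClosed_le continuous_const (by fun_prop))
    fun ζ hζ => ?_
  by_contra hn
  have h1 := hev.self_of_nhds ζ hn
  have h2 : M ≤ g w₀ ζ := hζ
  linarith

theorem IsSmoothable.exists_isMax [Nonempty Z] (h : IsSmoothable π g Dg w₀) :
    ∃ ζ, ∀ ζ', g w₀ ζ' ≤ g w₀ ζ := by
  obtain ⟨B, -, hB⟩ := h.coercive.exists_isMaxOn h.continuous
  obtain ⟨ζ, -, hζ⟩ := hB.self_of_nhds
  exact ⟨ζ, hζ⟩

theorem IsSmoothable.eventually_hasGradientAt [IsProbabilityMeasure π]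
    (h : IsSmoothable π g Dg w₀) :
    ∀ᶠ x : ℝ × H in 𝓝[>] 0 ×ˢ 𝓝 w₀, 0 < ∫ ζ, Real.exp (g x.2 ζ / x.1) ∂π ∧
      DifferentiableAt ℝ (logIntegralExp π g x.1) x.2 ∧
      ∀ e, inner ℝ (gradient (logIntegralExp π g x.1) x.2) e =
        (∫ ζ, Real.exp (g x.2 ζ / x.1) ∂π)⁻¹ *
          ∫ ζ, Real.exp (g x.2 ζ / x.1) * inner ℝ (Dg x.2 ζ) e ∂π := by
  obtain ⟨μ, hμ⟩ := h.bounded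
  obtain ⟨Φ, hΦ, hDgΦ⟩ := h.gradient_bounded
  have hβ : ∀ᶠ β : ℝ in 𝓝[>] 0, 0 < β := self_mem_nhdsWithin
  filter_upwards [hβ.prod_mk (hμ.eventually_nhds.and hDgΦ.eventually_nhds)]
  rintro ⟨β, w⟩ ⟨hβ, hμ, hDgΦ⟩
  have hg := h.continuous
  exact ⟨integral_exp_pos (integrable_exp_div hβ (by fun_prop : Continuous fun ζ => g w ζ)
    hμ.self_of_nhds), hasGradientAt_mul_log_integral_exp hβ hg h.continuous_gradient
      h.hasGradientAt hμ hΦ hDgΦ⟩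

/-- The point `ζ₀` maximises `⟨Dg w₀ ·, e⟩` over the compact set of maximisers of `g w₀`; the
Laplace principle then applies with `q = ⟨Dg, e⟩`. -/
theorem IsSmoothable.eventually_inner_gradient_le [Nonempty Z] [IsProbabilityMeasure π]
    [π.IsOpenPosMeasure] (h : IsSmoothable π g Dg w₀) (e : H) :
    ∃ ζ₀, (∀ ζ, g w₀ ζ ≤ g w₀ ζ₀) ∧ ∀ δ > 0, ∀ᶠ x : ℝ × H in 𝓝[>] 0 ×ˢ 𝓝 w₀,
      inner ℝ (gradient (logIntegralExp π g x.1) x.2) e ≤ inner ℝ (Dg w₀ ζ₀) e + δ := by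
  obtain ⟨ζ₁, hζ₁⟩ := h.exists_isMax
  have hDg := h.continuous_gradient
  obtain ⟨ζ₀, hζ₀, hmax⟩ := (h.isCompact_superlevel (g w₀ ζ₁)).exists_isMaxOn ⟨ζ₁, le_refl (g w₀ ζ₁)⟩
    (by fun_prop : Continuous fun ζ => inner ℝ (Dg w₀ ζ) e).continuousOn
  have hζ₀ : g w₀ ζ₁ ≤ g w₀ ζ₀ := hζ₀
  refine ⟨ζ₀, fun ζ => (hζ₁ ζ).trans hζ₀, fun δ hδ => ?_⟩
  obtain ⟨μ, hμ⟩ := h.bounded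
  obtain ⟨Φ, hΦ, hDgΦ⟩ := h.gradient_bounded
  have hlap := h.coercive.eventually_integral_exp_mul_le (π := π)
    (q := fun w ζ => inner ℝ (Dg w ζ) e) (Φ := fun ζ => Φ ζ * ‖e‖) (ζ₀ := ζ₀) (μ := μ)
    (m := inner ℝ (Dg w₀ ζ₀) e + δ / 2) (δ := δ / 2) h.continuous (by fun_prop) hμ
    (hΦ.mul_const _) (hDgΦ.mono fun w hw ζ => (abs_real_inner_le_norm _ _).trans
      (mul_le_mul_of_nonneg_right (hw ζ) (norm_nonneg _)))
    (fun ζ => (lt_or_ge (g w₀ ζ) (g w₀ ζ₀)).imp_right fun hge => by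
      have : inner ℝ (Dg w₀ ζ) e ≤ inner ℝ (Dg w₀ ζ₀) e := hmax (hζ₀.trans hge)
      linarith) (half_pos hδ)
  filter_upwards [hlap, h.eventually_hasGradientAt] with x hx ⟨hpos, _, hgr⟩
  rw [hgr, inv_mul_le_iff₀ hpos, mul_comm]
  refine hx.trans (le_of_eq ?_)
  ring

/-- Directional bounds hold near `w₀` only for each fixed direction; this bound confines the
gradients to a compact ball, where finitely many directions suffice. -/
theorem IsSmoothable.eventually_norm_gradient_le [Nonempty Z] [IsProbabilityMeasure π]
    [π.IsOpenPosMeasure] (h : IsSmoothable π g Dg w₀) :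
    ∃ K : ℝ, ∀ᶠ x : ℝ × H in 𝓝[>] 0 ×ˢ 𝓝 w₀,
      ‖gradient (logIntegralExp π g x.1) x.2‖ ≤ K := by
  obtain ⟨ζ₀, hζ₀⟩ := h.exists_isMax
  have hDg := h.continuous_gradient
  obtain ⟨K, hK0, hK⟩ := eventually_norm_lt_of_isCompact
    (h.isCompact_superlevel (g w₀ ζ₀)) hDg w₀
  obtain ⟨μ, hμ⟩ := h.bounded
  obtain ⟨Φ, hΦ, hDgΦ⟩ := h.gradient_bounded
  have hlap := h.coercive.eventually_integral_exp_mul_le (π := π)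
    (q := fun w ζ => ‖Dg w ζ‖) (Φ := Φ) (ζ₀ := ζ₀) (μ := μ) (m := K) (δ := 1)
    h.continuous (by fun_prop) hμ hΦ (hDgΦ.mono fun w hw ζ => by simpa using hw ζ)
    (fun ζ => (lt_or_ge (g w₀ ζ) (g w₀ ζ₀)).imp_right fun hge => hK.self_of_nhds ζ hge) one_pos
  have hβ : ∀ᶠ β : ℝ in 𝓝[>] 0, 0 < β := self_mem_nhdsWithin
  refine ⟨K + 1, ?_⟩
  filter_upwards [hlap, h.eventually_hasGradientAt, hβ.prod_mk (hμ.and hDgΦ)]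
    with ⟨β, w⟩ hx ⟨hpos, _, hgr⟩ ⟨hβ, hμ, hDgΦ⟩
  simp only at *
  -- The gradient is tested against itself. Since `v` varies with `(β, w)`, the Laplace principle
  -- was applied to `‖Dg‖` rather than to an inner product with `v`.
  set v := gradient (logIntegralExp π g β) w with hv
  have hg := h.continuous
  have hgw : Continuous fun ζ => g w ζ := by fun_prop
  have hDgw : Continuous fun ζ => Dg w ζ := by fun_prop
  have h1 : ∫ ζ, Real.exp (g w ζ / β) * inner ℝ (Dg w ζ) v ∂π ≤
      ∫ ζ, Real.exp (g w ζ / β) * ‖Dg w ζ‖ * ‖v‖ ∂π := by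
    refine integral_mono (integrable_exp_mul hβ hgw (by fun_prop) hμ (hΦ.mul_const ‖v‖)
      fun ζ => (abs_real_inner_le_norm _ _).trans
        (mul_le_mul_of_nonneg_right (hDgΦ ζ) (norm_nonneg _)))
      ((integrable_exp_mul hβ hgw hDgw.norm hμ hΦ fun ζ => by simpa using hDgΦ ζ).mul_const _)
      fun ζ => ?_
    simp only [mul_assoc]
    exact mul_le_mul_of_nonneg_left (real_inner_le_norm _ _) (Real.exp_pos _).le
  rw [integral_mul_const] at h1
  have h2 : ‖v‖ * ‖v‖ ≤ (K + 1) * ‖v‖ := by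
    rw [← real_inner_self_eq_norm_mul_norm, hgr v, inv_mul_le_iff₀ hpos]
    refine h1.trans ((mul_le_mul_of_nonneg_right hx (norm_nonneg _)).trans (le_of_eq (by ring)))
  rcases (norm_nonneg v).eq_or_lt with h0 | h0
  · rw [← h0]
    positivity
  · exact le_of_mul_le_mul_right h2 h0

/-! ### Sums of maxima -/

section Sum

variable {ι : Type*} [Fintype ι] {π : ι → Measure Z} {g : ι → H → Z → ℝ}
  {Dg : ι → H → Z → H} {r : H} {a : ℝ}

/-- Treating the sum as a single maximum over tuples avoids a sum rule for Clarke subdifferentials.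
-/
theorem isMaxNear_sum [Nonempty Z] (h : ∀ i, IsSmoothable (π i) (g i) (Dg i) w₀) (ha : 0 ≤ a) :
    ∃ B : Set (ι → Z), IsMaxNear (fun w => inner ℝ r w + a * ∑ i, ⨆ ζ, g i w ζ)
      (fun w ζ => inner ℝ r w + a * ∑ i, g i w (ζ i)) B w₀ := by
  choose B hB hmax using fun i => (h i).coercive.exists_isMaxOn (h i).continuous
  refine ⟨Set.univ.pi B, isCompact_univ_pi hB, ?_, ?_⟩
  · filter_upwards [eventually_all.2 hmax] with w hw ζ
    refine add_le_add_right (mul_le_mul_of_nonneg_left (Finset.sum_le_sum fun i _ => ?_) ha) _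
    obtain ⟨ζ', -, hζ'⟩ := hw i
    exact le_ciSup (f := fun ζ => g i w ζ) ⟨g i w ζ', by rintro _ ⟨η, rfl⟩; exact hζ' η⟩ (ζ i)
  · filter_upwards [eventually_all.2 hmax] with w hw
    choose ζ hζ hζ' using hw
    refine ⟨ζ, fun i _ => hζ i, ?_⟩
    have : ∀ i, g i w (ζ i) = ⨆ ζ, g i w ζ := fun i =>
      le_antisymm (le_ciSup (f := fun ζ => g i w ζ)
        ⟨g i w (ζ i), by rintro _ ⟨η, rfl⟩; exact hζ' i η⟩ (ζ i)) (ciSup_le (hζ' i))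
    simp only [this]

/-- Near `w₀` and for small `β`, the gradients of the smoothed sum of maxima are close to the
convex hull of the limits of gradients of the sum of maxima. -/
theorem eventually_gradient_mem_thickening [FiniteDimensional ℝ H] [Nonempty Z]
    [∀ i, IsProbabilityMeasure (π i)] [∀ i, (π i).IsOpenPosMeasure]
    (h : ∀ i, IsSmoothable (π i) (g i) (Dg i) w₀) (ha : 0 ≤ a) {ε : ℝ} (hε : 0 < ε) :
    ∀ᶠ x : ℝ × H in 𝓝[>] 0 ×ˢ 𝓝 w₀,
      DifferentiableAt ℝ
        (fun w => inner ℝ r w + a * ∑ i, logIntegralExp (π i) (g i) x.1 w) x.2 ∧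
      gradient (fun w => inner ℝ r w + a * ∑ i, logIntegralExp (π i) (g i) x.1 w) x.2 ∈
        Metric.thickening ε
          (clarkeSubdiff (fun w => inner ℝ r w + a * ∑ i, ⨆ ζ, g i w ζ) w₀) := by
  set F : H → ℝ := fun w => inner ℝ r w + a * ∑ i, ⨆ ζ, g i w ζ with hF
  set C := clarkeSubdiff F w₀ with hC
  set V : ℝ × H → H := fun x =>
    r + a • ∑ i, gradient (logIntegralExp (π i) (g i) x.1) x.2 with hV
  have hgrad : ∀ᶠ x : ℝ × H in 𝓝[>] 0 ×ˢ 𝓝 w₀, HasGradientAt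
      (fun w => inner ℝ r w + a * ∑ i, logIntegralExp (π i) (g i) x.1 w) (V x) x.2 := by
    filter_upwards [eventually_all.2 fun i => (h i).eventually_hasGradientAt] with x hx
    exact hasGradientAt_inner_add_sum r a fun i => (hx i).2.1.hasGradientAt
  suffices hmem : ∀ᶠ x in 𝓝[>] 0 ×ˢ 𝓝 w₀, V x ∈ Metric.thickening ε C by
    filter_upwards [hgrad, hmem] with x hx hxm
    rw [hx.gradient]
    exact ⟨hx.differentiableAt, hxm⟩
  choose K hK using fun i => (h i).eventually_norm_gradient_le
  have hbound : ∀ᶠ x in 𝓝[>] 0 ×ˢ 𝓝 w₀, V x ∈ Metric.closedBall 0 (‖r‖ + a * ∑ i, K i) := by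
    filter_upwards [eventually_all.2 hK] with x hx
    rw [mem_closedBall_zero_iff]
    refine (norm_add_le _ _).trans (add_le_add_right ?_ _)
    rw [norm_smul, Real.norm_of_nonneg ha]
    exact mul_le_mul_of_nonneg_left
      ((norm_sum_le _ _).trans (Finset.sum_le_sum fun i _ => hx i)) ha
  have hcompact : IsCompact (Metric.closedBall 0 (‖r‖ + a * ∑ i, K i) \ Metric.thickening ε C) :=
    (isCompact_closedBall _ _).diff Metric.isOpen_thickening
  have hout : ∀ᶠ x in 𝓝[>] 0 ×ˢ 𝓝 w₀,
      V x ∉ Metric.closedBall 0 (‖r‖ + a * ∑ i, K i) \ Metric.thickening ε C := by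
    -- By compactness it suffices that each point `v` of the bad set has a neighbourhood that `V`
    -- eventually avoids; an open half-space separating `v` from `closure C` will serve.
    refine hcompact.induction_on (p := fun S => ∀ᶠ x in 𝓝[>] 0 ×ˢ 𝓝 w₀, V x ∉ S) (by simp)
      (fun s t hst ht => ht.mono fun x hx hxs => hx (hst hxs))
      (fun s t hs ht => (hs.and ht).mono fun x hx => not_or.2 hx) fun v hv => ?_
    have hvC : v ∉ closure C := fun hvc => hv.2 (Metric.closure_subset_thickening hε _ hvc)
    obtain ⟨ℓ, u, hℓ, hu⟩ := geometric_hahn_banach_closed_point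
      (convex_convexHull ℝ _).closure isClosed_closure hvC
    obtain ⟨e, rfl⟩ := (InnerProductSpace.toDual ℝ H).surjective ℓ
    simp only [InnerProductSpace.toDual_apply_apply] at hℓ hu
    choose ζ hζ hlim using fun i => (h i).eventually_inner_gradient_le e
    obtain ⟨B, hB⟩ := isMaxNear_sum (r := r) h ha
    obtain ⟨v', hv', hdom⟩ := hB.exists_mem_limitGradients
      (DG := fun w ζ => r + a • ∑ i, Dg i w (ζ i))
      (fun w ζ => hasGradientAt_inner_add_sum r a fun i => (h i).hasGradientAt w (ζ i))
      (by
        have := fun i => (h i).continuous_gradient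
        fun_prop) e
    have hmax : ∀ i, g i w₀ (ζ i) = ⨆ ζ, g i w₀ ζ := fun i =>
      le_antisymm (le_ciSup (f := fun ζ => g i w₀ ζ)
        ⟨g i w₀ (ζ i), by rintro _ ⟨η, rfl⟩; exact hζ i η⟩ (ζ i)) (ciSup_le (hζ i))
    have hv'u := hℓ v' (subset_closure (subset_convexHull ℝ _ hv'))
    -- The limit of gradients `v'` lies in `C`, so `⟨v', e⟩ < u`; it dominates the active gradient
    -- of the tuple `ζ`, which in turn controls the smoothed gradients up to `δ` per term.
    have hdomζ := hdom ζ (by simp only [hmax])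
    rw [real_inner_comm] at hv'u
    have hlt := hdomζ.trans_lt hv'u
    obtain ⟨δ, hδ, hδu⟩ : ∃ δ > 0,
        inner ℝ (r + a • ∑ i, Dg i w₀ (ζ i)) e + a * ∑ _i : ι, δ ≤ u := by
      have hcont : Tendsto (fun δ : ℝ => inner ℝ (r + a • ∑ i, Dg i w₀ (ζ i)) e +
          a * ∑ _i : ι, δ) (𝓝[>] 0) (𝓝 (inner ℝ (r + a • ∑ i, Dg i w₀ (ζ i)) e +
          a * ∑ _i : ι, (0 : ℝ))) :=
        ((by fun_prop : Continuous fun δ : ℝ => inner ℝ (r + a • ∑ i, Dg i w₀ (ζ i)) e +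
          a * ∑ _i : ι, δ).tendsto 0).mono_left nhdsWithin_le_nhds
      rw [Finset.sum_const_zero, mul_zero, add_zero] at hcont
      obtain ⟨δ, hδ, hδ0⟩ := ((hcont.eventually (gt_mem_nhds hlt)).and self_mem_nhdsWithin).exists
      exact ⟨δ, hδ0, hδ.le⟩
    refine ⟨{y | u < inner ℝ e y}, mem_nhdsWithin_of_mem_nhds
      ((isOpen_lt continuous_const (by fun_prop)).mem_nhds hu), ?_⟩
    filter_upwards [eventually_all.2 fun i => hlim i δ hδ] with x hx
    refine not_lt.2 (le_trans ?_ hδu)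
    rw [real_inner_comm, inner_add_left, inner_add_left, add_assoc, real_inner_smul_left,
      real_inner_smul_left, ← mul_add, sum_inner, sum_inner, ← Finset.sum_add_distrib]
    exact add_le_add_right (mul_le_mul_of_nonneg_left (Finset.sum_le_sum fun i _ => hx i) ha) _
  filter_upwards [hbound, hout] with x hx hx'
  by_contra hn
  exact hx' ⟨hx, hn⟩

end Sum

end Consistency

/-! ### Verification for the loss, the cost and the reference distributions -/

section Instantiation

/-- A nonempty open set has a nonempty open section over some `y`. That section has positive
Lebesgue measure, so it is not null for the slice. -/
theorem isOpenPosMeasure_of_slice {d J : ℕ} {π : Measure (Sample d J)}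
    (h : ∀ y, (volume : Measure (EuclideanSpace ℝ (Fin d))) ≪ slice π y) :
    π.IsOpenPosMeasure := by
  refine ⟨fun U hU ⟨⟨x, y⟩, hxy⟩ h0 => ?_⟩
  have hV : IsOpen ((fun x => (x, y)) ⁻¹' U : Set (EuclideanSpace ℝ (Fin d))) :=
    hU.preimage (by fun_prop)
  refine (hV.measure_pos volume ⟨x, hxy⟩).ne' (h y ?_)
  rw [slice, Measure.map_apply measurable_fst hV.measurableSet,
    Measure.restrict_apply (measurable_fst hV.measurableSet)]
  refine measure_mono_null ?_ h0
  rintro ⟨x', y'⟩ ⟨hx', hy'⟩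
  obtain rfl : y' = y := hy'
  exact hx'

variable {p d J : ℕ} {T : Set (EuclideanSpace ℝ (Fin p))}
  {f : EuclideanSpace ℝ (Fin p) → Sample d J → ℝ} {c : Sample d J → Sample d J → ℝ}
  {π₀ : Sample d J → ProbabilityMeasure (Sample d J)} {lam : Sample d J → ℝ}

theorem continuous_of_continuous_slices {E X : Type*} [TopologicalSpace E] [TopologicalSpace X]
    {h : E → Sample d J → X}
    (hh : ∀ y, Continuous fun z : E × EuclideanSpace ℝ (Fin d) => h z.1 (z.2, y)) :
    Continuous fun q : E × Sample d J => h q.1 q.2 := by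
  have h1 : Continuous fun q : (E × EuclideanSpace ℝ (Fin d)) × Fin J => h q.1.1 (q.1.2, q.2) :=
    continuous_prod_of_discrete_right.2 hh
  exact h1.comp (by fun_prop : Continuous fun q : E × Sample d J => ((q.1, q.2.1), q.2.2))

theorem Assumptions.continuous_loss (hA : Assumptions T f c π₀ lam) :
    Continuous fun q : EuclideanSpace ℝ (Fin p) × Sample d J => f q.1 q.2 :=
  continuous_of_continuous_slices fun y => (hA.smooth y).1.continuous

theorem Assumptions.hasFDerivAt_loss (hA : Assumptions T f c π₀ lam)
    (θ : EuclideanSpace ℝ (Fin p)) (x : EuclideanSpace ℝ (Fin d)) (y : Fin J) :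
    HasFDerivAt (fun θ => f θ (x, y))
      ((fderiv ℝ (fun z : EuclideanSpace ℝ (Fin p) × EuclideanSpace ℝ (Fin d) =>
        f z.1 (z.2, y)) (θ, x)).comp (ContinuousLinearMap.inl ℝ _ _)) θ :=
  ((hA.smooth y).1 (θ, x)).hasFDerivAt.comp (f := fun θ => (θ, x)) θ (hasFDerivAt_prodMk_left θ x)

theorem Assumptions.continuous_gradient_loss (hA : Assumptions T f c π₀ lam) :
    Continuous fun q : EuclideanSpace ℝ (Fin p) × Sample d J =>
      gradient (fun θ => f θ q.2) q.1 := by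
  refine continuous_of_continuous_slices (h := fun θ ζ => gradient (fun θ => f θ ζ) θ) fun y => ?_
  refine (InnerProductSpace.toDual ℝ (EuclideanSpace ℝ (Fin p))).symm.continuous.comp ?_
  have : ∀ z : EuclideanSpace ℝ (Fin p) × EuclideanSpace ℝ (Fin d),
      fderiv ℝ (fun θ => f θ (z.2, y)) z.1 = _ := fun z =>
    (hA.hasFDerivAt_loss z.1 z.2 y).fderiv
  simp only [this]
  exact (hA.smooth y).2.clm_comp continuous_const

/-- Since `t > lam ξ / 2`, a multiple `τ > 0` of the cost survives the growth bound: `g ≤ μ - τ c`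
near `w₀`. This gives both the upper bound and the coercivity; `ψ + c` dominates the gradient, whose
`t`-component is `-c`. -/
theorem Assumptions.isSmoothable (hA : Assumptions T f c π₀ lam) (hT : IsOpen T)
    (ξ : Sample d J) {w₀ : Param p} (hθ : w₀.fst ∈ T) (ht : lam ξ / 2 < w₀.snd) :
    IsSmoothable (π₀ ξ : Measure (Sample d J)) (fun w ζ => f w.fst ζ - w.snd * c ξ ζ)
      (fun w ζ => WithLp.toLp 2 (gradient (fun θ => f θ ζ) w.fst, -c ξ ζ)) w₀ := by
  have hfst : Continuous (WithLp.fst : Param p → _) := WithLp.continuous_fst _ _ _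
  have hsnd : Continuous (WithLp.snd : Param p → _) := WithLp.continuous_snd _ _ _
  have hcξ : Continuous (c ξ) := (hA.cost_coercive ξ).1
  have hT' : ∀ᶠ w : Param p in 𝓝 w₀, w.fst ∈ T := hfst.continuousAt.eventually (hT.mem_nhds hθ)
  obtain ⟨μ, hμ⟩ := hA.growth ξ
  obtain ⟨τ, hτ, hτt⟩ : ∃ τ > 0, lam ξ / 2 + τ < w₀.snd :=
    ⟨(w₀.snd - lam ξ / 2) / 2, by linarith, by linarith⟩
  have hle : ∀ᶠ w : Param p in 𝓝 w₀, ∀ ζ, f w.fst ζ - w.snd * c ξ ζ ≤ μ - τ * c ξ ζ := by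
    filter_upwards [hT', hsnd.continuousAt.eventually (lt_mem_nhds hτt)] with w hw hwt ζ
    have h1 := hμ _ hw ζ
    have h2 := mul_le_mul_of_nonneg_right hwt.le (hA.cost_nonneg ξ ζ)
    linarith
  refine ⟨?_, ?_, fun w ζ => ?_, fun R => ?_, ⟨μ, ?_⟩, ?_⟩
  · have h1 : Continuous fun q : Param p × Sample d J => f q.1.fst q.2 :=
      hA.continuous_loss.comp ((hfst.comp continuous_fst).prodMk continuous_snd)
    exact h1.sub ((hsnd.comp continuous_fst).mul (hcξ.comp continuous_snd))
  · have h1 : Continuous fun q : Param p × Sample d J => gradient (fun θ => f θ q.2) q.1.fst :=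
      hA.continuous_gradient_loss.comp ((hfst.comp continuous_fst).prodMk continuous_snd)
    exact (WithLp.prod_continuous_toLp 2 _ _).comp
      (h1.prodMk (hcξ.comp continuous_snd).neg)
  · have h1 : HasGradientAt (fun θ => f θ ζ) (gradient (fun θ => f θ ζ) w.fst) w.fst :=
      (hA.hasFDerivAt_loss w.fst ζ.1 ζ.2).differentiableAt.hasGradientAt
    have h2 : HasFDerivAt (fun θ => f θ ζ)
      (innerSL ℝ (gradient (fun θ => f θ ζ) w.fst)) w.fst := h1.hasFDerivAt
    have h3 : HasFDerivAt (fun w : Param p => f w.fst ζ - w.snd * c ξ ζ) _ w :=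
      (h2.comp w (WithLp.fstL 2 ℝ (EuclideanSpace ℝ (Fin p)) ℝ).hasFDerivAt).sub
        ((WithLp.sndL 2 ℝ (EuclideanSpace ℝ (Fin p)) ℝ).hasFDerivAt.mul_const (c ξ ζ))
    refine (HasFDerivAt.congr_fderiv h3 ?_ :
      HasFDerivAt _ (innerSL ℝ (WithLp.toLp 2 (gradient (fun θ => f θ ζ) w.fst, -c ξ ζ) :
        Param p)) w)
    ext e
    simp [WithLp.prod_inner_apply]
    ring
  · refine ⟨_, (hA.cost_coercive ξ).2 ((μ - R) / τ), ?_⟩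
    filter_upwards [hle] with w hw ζ hζ
    have h1 : (μ - R) / τ < c ξ ζ := not_le.1 hζ
    rw [div_lt_iff₀ hτ] at h1
    linarith [hw ζ]
  · filter_upwards [hle] with w hw ζ
    linarith [hw ζ, mul_nonneg hτ.le (hA.cost_nonneg ξ ζ)]
  · obtain ⟨a, ha, ψ, hψ, hc, hgψ, hψa⟩ := hA.reference_moments
    -- Integrability of `φ` follows from `φ ≤ 1 + φ ^ (1 + a)`.
    have hint : ∀ φ : Sample d J → ℝ, Continuous φ → (∀ ζ, 0 ≤ φ ζ) →
        Integrable (fun ζ => φ ζ ^ (1 + a)) (π₀ ξ : Measure (Sample d J)) →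
        Integrable φ (π₀ ξ : Measure (Sample d J)) := by
      intro φ hφ hφ0 hφa
      refine ((integrable_const (1 : ℝ)).add hφa).mono' hφ.aestronglyMeasurable
        (ae_of_all _ fun ζ => ?_)
      rw [Real.norm_of_nonneg (hφ0 ζ), Pi.add_apply]
      rcases le_total (φ ζ) 1 with h1 | h1
      · linarith [Real.rpow_nonneg (hφ0 ζ) (1 + a)]
      · have := Real.rpow_le_rpow_of_exponent_le h1 (by linarith : (1 : ℝ) ≤ 1 + a)
        rw [Real.rpow_one] at this
        linarith
    refine ⟨fun ζ => ψ ζ + c ξ ζ, (hint ψ hψ.1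
      (fun ζ => ((norm_nonneg _).trans_lt (hgψ ζ _ hθ)).le) (hψa ξ)).add
        (hint _ hcξ (hA.cost_nonneg ξ) (hc ξ)), ?_⟩
    filter_upwards [hT'] with w hw ζ
    have hsplit : (WithLp.toLp 2 (gradient (fun θ => f θ ζ) w.fst, -c ξ ζ) : Param p) =
        WithLp.toLp 2 (gradient (fun θ => f θ ζ) w.fst, 0) + WithLp.toLp 2 (0, -c ξ ζ) := by
      rw [← WithLp.toLp_add, Prod.mk_add_mk, add_zero, zero_add]
    rw [hsplit]
    refine (norm_add_le _ _).trans ?_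
    rw [WithLp.norm_toLp_fst, WithLp.norm_toLp_snd, norm_neg,
      Real.norm_of_nonneg (hA.cost_nonneg ξ ζ)]
    exact add_le_add_left (hgψ ζ _ hw).le _

theorem isCompact_multipliers {n : ℕ} (hn : 0 < n) (lamMax : ℝ) (ξ : Fin n → Sample d J) :
    IsCompact (multipliers lam lamMax ξ) :=
  IsCompact.of_isClosed_subset isCompact_Icc (isClosed_iInter fun _ => isClosed_Icc)
    (iInter_subset _ ⟨0, hn⟩)

end Instantiation

end WDRO

end

/-! ### Uniform gradient consistency -/

theorem mainTheorem4 {p d J n : ℕ} (hn : 0 < n)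
    (Θ Θ' : Set (EuclideanSpace ℝ (Fin p)))
    (hΘ_compact : IsCompact Θ) (hΘ_convex : Convex ℝ Θ)
    (hΘ'_open : IsOpen Θ') (hΘΘ' : Θ ⊆ Θ')
    (f : EuclideanSpace ℝ (Fin p) → WDRO.Sample d J → ℝ)
    (c : WDRO.Sample d J → WDRO.Sample d J → ℝ)
    (π₀ : WDRO.Sample d J → ProbabilityMeasure (WDRO.Sample d J))
    (lam : WDRO.Sample d J → ℝ)
    (hA : WDRO.Assumptions Θ' f c π₀ lam)
    (ξ : Fin n → WDRO.Sample d J) (ρ lamMax : ℝ)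
    (hΛ_pos : WDRO.multipliers lam lamMax ξ ⊆ Ioi 0)
    (ε : ℝ) (hε : 0 < ε) :
    ∃ βε : ℝ, 0 < βε ∧ ∀ β : ℝ, 0 < β → β ≤ βε →
      ∀ θ ∈ Θ, ∀ t ∈ WDRO.multipliers lam lamMax ξ,
        DifferentiableAt ℝ (WDRO.smoothObjective ρ f c π₀ ξ β) (WithLp.toLp 2 (θ, t)) ∧
        gradient (WDRO.smoothObjective ρ f c π₀ ξ β) (WithLp.toLp 2 (θ, t)) ∈
          WDRO.enlargement (WDRO.clarkeSubdiff (WDRO.objective ρ f c ξ)) ε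
            (WithLp.toLp 2 (θ, t)) := by
  have hinner : ∀ w : WDRO.Param p,
      inner ℝ (WithLp.toLp 2 ((0 : EuclideanSpace ℝ (Fin p)), ρ)) w = w.snd * ρ := fun w => by
    simp [WithLp.prod_inner_apply]
  have hsmooth : ∀ β, WDRO.smoothObjective ρ f c π₀ ξ β = fun w =>
      inner ℝ (WithLp.toLp 2 ((0 : EuclideanSpace ℝ (Fin p)), ρ)) w + (n : ℝ)⁻¹ * ∑ i,
        WDRO.logIntegralExp (π₀ (ξ i) : Measure (WDRO.Sample d J))
          (fun w ζ => f w.fst ζ - w.snd * c (ξ i) ζ) β w := fun β => by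
    funext w
    rw [hinner]
    rfl
  have hobj : WDRO.objective ρ f c ξ = fun w =>
      inner ℝ (WithLp.toLp 2 ((0 : EuclideanSpace ℝ (Fin p)), ρ)) w + (n : ℝ)⁻¹ * ∑ i,
        ⨆ ζ, (f w.fst ζ - w.snd * c (ξ i) ζ) := by
    funext w
    rw [hinner]
    rfl
  have : Nonempty (WDRO.Sample d J) := ⟨ξ ⟨0, hn⟩⟩
  have : ∀ i, (π₀ (ξ i) : Measure (WDRO.Sample d J)).IsOpenPosMeasure := fun i =>
    WDRO.isOpenPosMeasure_of_slice (hA.reference_null (ξ i))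
  have hK : IsCompact ((WithLp.toLp 2 : _ → WDRO.Param p) ''
      (Θ ×ˢ WDRO.multipliers lam lamMax ξ)) :=
    (hΘ_compact.prod (WDRO.isCompact_multipliers hn lamMax ξ)).image
      (WithLp.prod_continuous_toLp 2 _ _)
  have hlocal : ∀ w₀ ∈ (WithLp.toLp 2 : _ → WDRO.Param p) ''
      (Θ ×ˢ WDRO.multipliers lam lamMax ξ), ∃ s ∈ 𝓝[(WithLp.toLp 2 : _ → WDRO.Param p) ''
      (Θ ×ˢ WDRO.multipliers lam lamMax ξ)] w₀, ∀ᶠ β in 𝓝[>] (0 : ℝ), ∀ w ∈ s,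
        DifferentiableAt ℝ (WDRO.smoothObjective ρ f c π₀ ξ β) w ∧
        gradient (WDRO.smoothObjective ρ f c π₀ ξ β) w ∈
          WDRO.enlargement (WDRO.clarkeSubdiff (WDRO.objective ρ f c ξ)) ε w := by
    rintro _ ⟨⟨θ, t⟩, ⟨hθ, ht⟩, rfl⟩
    -- Positivity gives `lam (ξ i) / 2 < t` even when `lam (ξ i) = 0`; otherwise `lam (ξ i) ≤ t`
    -- would suffice.
    have ht0 : 0 < t := hΛ_pos ht
    have hsm := fun i => hA.isSmoothable hΘ'_open (ξ i) (w₀ := WithLp.toLp 2 (θ, t)) (hΘΘ' hθ)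
      (by
        change lam (ξ i) / 2 < t
        linarith [(mem_iInter.1 ht i).1, hA.lam_nonneg (ξ i)])
    have hev := WDRO.eventually_gradient_mem_thickening
      (r := WithLp.toLp 2 ((0 : EuclideanSpace ℝ (Fin p)), ρ)) hsm
      (inv_nonneg.2 (Nat.cast_nonneg n)) hε
    simp only [← hsmooth, ← hobj] at hev
    obtain ⟨q, hq, q', hq', hqq⟩ := eventually_prod_iff.1 hev
    -- The nearby subgradient belongs to the base point `w₀`, not to `w`; the closed `ε`-ball keeps
    -- `w₀` admissible in the enlargement at `w`.
    refine ⟨_, mem_nhdsWithin_of_mem_nhds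
      (inter_mem hq' (Metric.closedBall_mem_nhds _ hε)), ?_⟩
    filter_upwards [hq] with β hβ w hw
    obtain ⟨hd, hg⟩ := hqq hβ hw.1
    obtain ⟨v, hv, hvd⟩ := Metric.mem_thickening_iff.1 hg
    rw [dist_eq_norm] at hvd
    exact ⟨hd, v, _, hv, hvd.le, by simpa only [dist_eq_norm] using Metric.mem_closedBall.1 hw.2⟩
  have hall := hK.induction_on (p := fun s => ∀ᶠ β in 𝓝[>] (0 : ℝ), ∀ w ∈ s,
        DifferentiableAt ℝ (WDRO.smoothObjective ρ f c π₀ ξ β) w ∧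
        gradient (WDRO.smoothObjective ρ f c π₀ ξ β) w ∈
          WDRO.enlargement (WDRO.clarkeSubdiff (WDRO.objective ρ f c ξ)) ε w)
    (by simp) (fun s t hst ht => ht.mono fun β h w hw => h w (hst hw))
    (fun s t hs ht => (hs.and ht).mono fun β h w hw => hw.elim (h.1 w) (h.2 w)) hlocal
  obtain ⟨b, hb, hIoc⟩ := mem_nhdsGT_iff_exists_Ioc_subset.1 hall
  exact ⟨b, hb, fun β hβ hβb θ hθ t ht =>
    hIoc ⟨hβ, hβb⟩ _ (mem_image_of_mem _ (mk_mem_prod hθ ht))⟩
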